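/- Let $Q,M\ge 1$ and $k\ge 0$ be integers and let $U=\mathbb Z/Q\times\mathbb Z/M$ be the pixel grid with periodic boundary conditions. For a feature map $F\in\mathbb R^{U\times k}$ let $$\mathcal G[F](i,j)=\frac1{|U|}\sum_{p\in U}F(p,i)F(p,j),\qquad \mathcal S[F](p,n)=\frac1{|U|}\sum_{p'\in U}F(p',n)F(p+p',n)$$ be its Gram matrix and its correlation, let $m_F=\frac1{|U|}\sum_{p}F(p)\in\mathbb R^k$ and $\mathcal C_F(p,i,j)=\frac1{|U|}\sum_{p'}(F(p',i)-m_{F,i})(F(p+p',j)-m_{F,j})$. For $m\in\mathbb R^k$ and $\mathcal C\in\mathbb R^{U\times k\times k}$ let $\mu(m,\mathcal C)$ be the Gaussian law on $\mathbb R^{U\times k}$ of a field $X$ with $\mathbb E X(p,i)=m_i$ and $\operatorname{Cov}(X(p,i),X(q,j))=\mathcal C(q-p,i,j)$; the stationary Gaussian model of $F$ is $\mu_F=\mu(m_F,\mathcal C_F)$. The Gram matrix and the correlation of a stationary law with mean $m$ and covariance $\mathcal C$ are $\mathcal C(0)+mm^T$ and $p\mapsto\operatorname{diag}(\mathcal C(p))+m\odot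 m$. An optimal transport interpolation from $\mu_0$ to $\mu_1$ is a family $(\mu_\rho)_{\rho\in[0,1]}$ for which there is a coupling $\pi$ of $\mu_0$ and $\mu_1$, optimal for the cost $\|x-y\|^2$ (Euclidean norm), such that $\mu_\rho$ is the image of $\pi$ under $(x,y)\mapsto(1-\rho)x+\rho y$ for every $\rho\in[0,1]$. Let $F_0,F_1\in\mathbb R^{U\times k}$, let $\hat{\ }$ denote the discrete Fourier transform on $U$ (channel by channel) and $^*$ the conjugate transpose, and put $$\hat G(w)=\hat F_1(w)\,\frac{\hat F_1(w)^*\hat F_0(w)}{|\hat F_1(w)^*\hat F_0(w)|},\qquad w\in U,$$ where the fraction is read as $1$ if its denominator vanishes. Then: 1. For every $\rho\in[0,1]$ there is a (unique) real feature map $F_\rho\in\mathbb R^{U\times k}$ with $\hat F_\rho=(1-\rho)\hat F_0+\rho\hat G$, namely the real part of the inverse Fourier transform of the right-hand side. 2. The family $\rho\mapsto\mu\big((1-\rho)m_{F_0}+\rho m_{F_1},\,\mathcal C_{F_\rho}\big)$ is an optimal transport interpolation from $\mu_{F_0}$ to $\mu_{F_1}$; it is the only one if $\hat F_1(w)^*\hat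 F_0(w)\ne0$ for all $w\ne0$. 3. If $\langle m_{F_0},m_{F_1}\rangle\ge0$ (for instance if $F_0$ and $F_1$ are nonnegative), then $\rho\mapsto\mu_{F_\rho}$ is an optimal transport interpolation from $\mu_{F_0}$ to $\mu_{F_1}$. If moreover $\hat F_1(w)^*\hat F_0(w)\ne0$ for all $w\ne0$, then every optimal transport interpolation $(\mu_\rho)$ from $\mu_{F_0}$ to $\mu_{F_1}$ satisfies $\mu_\rho=\mu_{F_\rho}$ for all $\rho\in[0,1]$, and the interpolated Gram matrix $\mathcal G_\rho$ and correlation $\mathcal S_\rho$, that is, those of the law $\mu_\rho$, are $$\mathcal G_\rho(i,j)=\frac1{|U|}\sum_{p\in U}F_\rho(p,i)F_\rho(p,j),\qquad \mathcal S_\rho(p,n)=\frac1{|U|}\sum_{p'\in U}F_\rho(p',n)F_\rho(p+p',n).$$ 4. In all cases, for every $\rho\in[0,1]$ the Gram matrix and the correlation of the law $\mu_{F_\rho}$ are $\mathcal G[F_\rho]$ and $\mathcal S[F_\rho]$; these depend continuously on $\rho\in[0,1]$ and are equal to $\mathcal G[F_0]$, $\mathcal S[F_0]$ at $\rho=0$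 and to $\mathcal G[F_1]$, $\mathcal S[F_1]$ (those of the given map $F_1$) at $\rho=1$. -/

import Mathlib

open MeasureTheory ProbabilityTheory

noncomputable section

namespace TextureMixing

/-! ### Feature maps on a periodic pixel grid and their statistics -/

/-- The `Q × M` pixel grid with periodic boundary conditions. -/
abbrev Grid (Q M : ℕ) : Type := ZMod Q × ZMod M

/-- A real feature map with `k` channels: `F p i` is channel `i` at pixel `p`. -/
abbrev FeatureMap (Q M k : ℕ) : Type := Grid Q M → Fin k → ℝ

variable {Q M k : ℕ} [NeZero Q] [NeZero M]

/-- The Gram matrix `(1/|U|) ∑ p, F(p,i) F(p,j)`. -/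
def gram (F : FeatureMap Q M k) (i j : Fin k) : ℝ :=
  (1 / (Fintype.card (Grid Q M) : ℝ)) * ∑ p, F p i * F p j

/-- The periodic correlation `(1/|U|) ∑ p', F(p',n) F(p+p',n)`. -/
def correlation (F : FeatureMap Q M k) (p : Grid Q M) (n : Fin k) : ℝ :=
  (1 / (Fintype.card (Grid Q M) : ℝ)) * ∑ p', F p' n * F (p + p') n

/-- The mean vector `(1/|U|) ∑ p, F(p)`. -/
def mean (F : FeatureMap Q M k) (i : Fin k) : ℝ :=
  (1 / (Fintype.card (Grid Q M) : ℝ)) * ∑ p, F p i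

/-- The empirical stationary covariance
`(1/|U|) ∑ p', (F(p',i) - m_i) (F(p+p',j) - m_j)`. -/
def covariance (F : FeatureMap Q M k) (p : Grid Q M) (i j : Fin k) : ℝ :=
  (1 / (Fintype.card (Grid Q M) : ℝ)) *
    ∑ p', (F p' i - mean F i) * (F (p + p') j - mean F j)

/-! ### Stationary Gaussian models -/

/-- The space `ℝ^(U × k)` of random fields, with its Euclidean norm. -/
abbrev Field (Q M k : ℕ) : Type := EuclideanSpace ℝ (Grid Q M × Fin k)

/-- The stationary Gaussian model `μ(m, C)`: the Gaussian law of a field `X` whose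
coordinates `X(p,i)` have mean `m i` and for which the covariance of `X(p,i)` and `X(q,j)`
is `C (q - p) i j`. -/
def gaussianModel (m : Fin k → ℝ) (C : Grid Q M → Fin k → Fin k → ℝ) :
    Measure (Field Q M k) :=
  multivariateGaussian (WithLp.toLp 2 fun a => m a.2)
    (Matrix.of fun a b => C (b.1 - a.1) a.2 b.2)

/-- The stationary Gaussian model associated with a feature map. -/
def modelOf (F : FeatureMap Q M k) : Measure (Field Q M k) :=
  gaussianModel (mean F) (covariance F)

/-- The mean vector of a stationary law. -/
def lawMean (μ : Measure (Field Q M k)) (i : Fin k) : ℝ :=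
  ∫ x, x (0, i) ∂μ

/-- The covariance function of a stationary law: covariance of `X(0,i)` and `X(p,j)`. -/
def lawCovariance (μ : Measure (Field Q M k)) (p : Grid Q M) (i j : Fin k) : ℝ :=
  cov[fun x => x (0, i), fun x => x (p, j); μ]

/-- The Gram matrix of a stationary law: `C(0) + m mᵀ`. -/
def lawGram (μ : Measure (Field Q M k)) (i j : Fin k) : ℝ :=
  lawCovariance μ 0 i j + lawMean μ i * lawMean μ j

/-- The correlation of a stationary law: `diag (C(p)) + m ⊙ m`. -/
def lawCorrelation (μ : Measure (Field Q M k)) (p : Grid Q M) (n : Fin k) : ℝ :=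
  lawCovariance μ p n n + lawMean μ n * lawMean μ n

/-! ### Optimal transport interpolation for the quadratic cost -/

/-- `π` is a coupling of `μ` and `ν`. -/
def IsCoupling {E : Type*} [MeasurableSpace E] (π : Measure (E × E)) (μ ν : Measure E) : Prop :=
  π.map Prod.fst = μ ∧ π.map Prod.snd = ν

/-- The quadratic transport cost of a plan. -/
def transportCost {E : Type*} [NormedAddCommGroup E] [MeasurableSpace E]
    (π : Measure (E × E)) : ENNReal :=
  ∫⁻ z, ‖z.1 - z.2‖ₑ ^ 2 ∂π

/-- `π` is an optimal coupling of `μ` and `ν`: its cost is the squared Wasserstein-2 distance. -/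
def IsOptimalCoupling {E : Type*} [NormedAddCommGroup E] [MeasurableSpace E]
    (π : Measure (E × E)) (μ ν : Measure E) : Prop :=
  IsCoupling π μ ν ∧ ∀ π' : Measure (E × E), IsCoupling π' μ ν → transportCost π ≤ transportCost π'

/-- `ρ ↦ γ ρ`, `ρ ∈ [0,1]`, is an optimal transport (displacement) interpolation from `μ₀` to
`μ₁`: there is an optimal coupling along whose straight segments the mass moves. -/
def IsOTInterpolation {E : Type*} [NormedAddCommGroup E] [NormedSpace ℝ E] [MeasurableSpace E]
    (μ₀ μ₁ : Measure E) (γ : ℝ → Measure E) : Prop :=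
  ∃ π : Measure (E × E), IsOptimalCoupling π μ₀ μ₁ ∧
    ∀ ρ ∈ Set.Icc (0 : ℝ) 1, γ ρ = π.map (fun z => (1 - ρ) • z.1 + ρ • z.2)

/-! ### The mixed feature map, defined in the Fourier domain -/

/-- The character `p ↦ exp (2πi (w₁ p₁ / Q + w₂ p₂ / M))` of the grid. -/
def gridChar (w p : Grid Q M) : ℂ :=
  ZMod.stdAddChar (w.1 * p.1) * ZMod.stdAddChar (w.2 * p.2)

/-- The discrete Fourier transform of a feature map, channel by channel. -/
def fourier (F : FeatureMap Q M k) (w : Grid Q M) (i : Fin k) : ℂ :=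
  ∑ p, (F p i : ℂ) * gridChar w (-p)

/-- The scalar `F̂₁(w)* F̂₀(w)`, where `*` is the conjugate transpose. -/
def crossSpectrum (F₀ F₁ : FeatureMap Q M k) (w : Grid Q M) : ℂ :=
  ∑ i, star (fourier F₁ w i) * fourier F₀ w i

/-- The phase factor `z / |z|`, read as `1` where `z = 0`. -/
def phase (z : ℂ) : ℂ :=
  if z = 0 then 1 else z / (‖z‖ : ℂ)

/-- `Ĝ(w) = F̂₁(w) (F̂₁(w)* F̂₀(w)) / |F̂₁(w)* F̂₀(w)|`. -/
def alignedFourier (F₀ F₁ : FeatureMap Q M k) (w : Grid Q M) (i : Fin k) : ℂ :=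
  fourier F₁ w i * phase (crossSpectrum F₀ F₁ w)

/-- The mixed feature map `F_ρ`: the inverse discrete Fourier transform of
`(1 - ρ) F̂₀ + ρ Ĝ`. The real part only serves to land in real feature maps; that nothing is
lost by taking it is part of what has to be proved. -/
def mix (F₀ F₁ : FeatureMap Q M k) (ρ : ℝ) : FeatureMap Q M k := fun p i =>
  ((1 / (Fintype.card (Grid Q M) : ℂ)) * ∑ w,
    ((1 - (ρ : ℂ)) * fourier F₀ w i + (ρ : ℂ) * alignedFourier F₀ F₁ w i) * gridChar w p).re

end TextureMixing

end

noncomputable section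

namespace TextureMixing

variable {Q M k : ℕ} [NeZero Q] [NeZero M]

/-! ### Characters of the grid -/

/-! The stationary Gaussian model of `F` is the law of white noise filtered by the centered map: `m
+ N^(-1/2) ∑ q, H(p+q) ξ(q)` with `H = center F` and `N = |U|` (`map_synthesis`). Multiplying the
spectrum of a filter by a unit phase at each frequency, the same for all channels, changes neither
its correlations nor this law (`crossCorrelation_eq_of_phase`). Hence `F₁` may be replaced by the
map with spectrum `Ĝ`, whose cross spectrum with `F₀` is `|F̂₁* F̂₀| ≥ 0`. Driving both filters by
the same noise couples the two models, and since filtering is linear in the filter, the coupling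
interpolates through the models of the segment of filters, which is `mix`.

Optimality is Kantorovich duality (`isOptimalCoupling_of_potentials`). A filtered noise has almost
surely a spectrum `a(w) Ĥ(w)` with one scalar amplitude per frequency. For two such fields, with
amplitudes `a`, `b` and cross spectrum `c` of the filters, explicit quadratic potentials fall short
of the cost by exactly `(1/N) ∑ w, |c(w)| |a(w) phase(c(w)) - b(w)|²` (`norm_sq_sub_sub_potential`).
This gap is nonnegative and vanishes for the common-noise coupling. Along any other optimal coupling
it vanishes almost everywhere; where `c ≠ 0` it determines `b` from `a`, so every optimal coupling
lies on the graph of one map and is unique (`eq_transportMap`).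

Centering removes the frequency `0`, so means move linearly on their own. The mixed map has that
linear mean when the phase at frequency `0` is `1`, which `⟨m₀, m₁⟩ ≥ 0` ensures. -/

theorem gridChar_comm (w p : Grid Q M) : gridChar w p = gridChar p w := by
  simp only [gridChar, mul_comm]

theorem gridChar_add (w p q : Grid Q M) : gridChar w (p + q) = gridChar w p * gridChar w q := by
  simp only [gridChar, Prod.fst_add, Prod.snd_add, mul_add, AddChar.map_add_eq_mul]
  ring

theorem gridChar_neg_left (w p : Grid Q M) : gridChar (-w) p = gridChar w (-p) := by
  simp [gridChar]

@[simp] theorem gridChar_zero_left (p : Grid Q M) : gridChar 0 p = 1 := by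
  simp [gridChar]

theorem star_gridChar (w p : Grid Q M) : star (gridChar w p) = gridChar w (-p) := by
  have h : ∀ {n : ℕ} [NeZero n] (a : ZMod n),
      star (ZMod.stdAddChar a : ℂ) = ZMod.stdAddChar (-a) := fun a => by
    rw [AddChar.map_neg_eq_conj]; rfl
  simp [gridChar, h]

theorem star_gridChar_neg (w p : Grid Q M) : star (gridChar w (-p)) = gridChar w p := by
  rw [star_gridChar, neg_neg]

theorem sum_gridChar_left (p : Grid Q M) :
    ∑ w : Grid Q M, gridChar w p = if p = 0 then (Fintype.card (Grid Q M) : ℂ) else 0 := by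
  simp only [gridChar]
  rw [← Finset.univ_product_univ, Finset.sum_product]
  simp only [← Finset.mul_sum, ← Finset.sum_mul]
  rw [AddChar.sum_mulShift _ (ZMod.isPrimitive_stdAddChar Q),
    AddChar.sum_mulShift _ (ZMod.isPrimitive_stdAddChar M)]
  obtain ⟨a, b⟩ := p
  by_cases ha : a = 0 <;> by_cases hb : b = 0 <;> simp [ha, hb]

theorem card_grid_ne_zero : (Fintype.card (Grid Q M) : ℂ) ≠ 0 :=
  Nat.cast_ne_zero.2 Fintype.card_ne_zero

theorem card_grid_pos : 0 < (Fintype.card (Grid Q M) : ℝ) :=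
  Nat.cast_pos.2 Fintype.card_pos

/-! ### Fourier inversion and Plancherel's formula -/

theorem sum_fourier_mul_gridChar (F : FeatureMap Q M k) (q : Grid Q M) (i : Fin k) :
    ∑ w, fourier F w i * gridChar w q = (Fintype.card (Grid Q M) : ℂ) * F q i := by
  simp only [fourier, Finset.sum_mul, mul_assoc, ← gridChar_add]
  rw [Finset.sum_comm]
  simp only [← Finset.mul_sum, sum_gridChar_left, neg_add_eq_zero]
  simp [mul_comm]

theorem eq_of_fourier_eq {F G : FeatureMap Q M k} (h : ∀ w i, fourier F w i = fourier G w i) :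
    F = G := by
  funext q i
  have h1 := sum_fourier_mul_gridChar F q i
  simp only [h, sum_fourier_mul_gridChar] at h1
  exact_mod_cast (mul_left_cancel₀ card_grid_ne_zero h1).symm

theorem star_fourier (F : FeatureMap Q M k) (w : Grid Q M) (i : Fin k) :
    star (fourier F w i) = ∑ p, (F p i : ℂ) * gridChar w p := by
  simp only [fourier, star_sum, star_mul', star_gridChar_neg]
  simp

theorem fourier_neg (F : FeatureMap Q M k) (w : Grid Q M) (i : Fin k) :
    fourier F (-w) i = star (fourier F w i) := by
  rw [star_fourier]; simp [fourier, gridChar_neg_left]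

/-- A Hermitian-symmetric spectrum is the Fourier transform of the real part of its inverse
transform. -/
theorem fourier_re_inverse {f : Grid Q M → Fin k → ℂ} (hf : ∀ w i, f (-w) i = star (f w i))
    (w : Grid Q M) (i : Fin k) :
    fourier (fun p i => ((1 / (Fintype.card (Grid Q M) : ℂ)) *
      ∑ w, f w i * gridChar w p).re) w i = f w i := by
  -- Conjugation amounts to `w ↦ -w` in the inversion sum, so the sum is already real.
  have hre : ∀ p, ((((1 / (Fintype.card (Grid Q M) : ℂ)) *
      ∑ w, f w i * gridChar w p).re : ℝ) : ℂ) =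
      (1 / (Fintype.card (Grid Q M) : ℂ)) * ∑ w, f w i * gridChar w p := by
    intro p
    rw [← Complex.conj_eq_iff_re, map_mul, map_sum]
    congr 1
    · simp
    · refine Fintype.sum_equiv (Equiv.neg _) _ _ fun w => ?_
      rw [Equiv.neg_apply, hf, gridChar_neg_left, ← star_gridChar, map_mul]; rfl
  simp only [fourier, hre]
  simp only [Finset.sum_mul, Finset.mul_sum]
  rw [Finset.sum_comm, Finset.sum_eq_single w]
  · have : ∀ p, 1 / (Fintype.card (Grid Q M) : ℂ) * (f w i * gridChar w p) * gridChar w (-p) =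
        1 / (Fintype.card (Grid Q M) : ℂ) * f w i := fun p => by
      rw [mul_assoc, mul_assoc, ← gridChar_add, add_neg_cancel, gridChar_comm, gridChar_zero_left,
        mul_one]
    simp only [this, Finset.sum_const, Finset.card_univ, nsmul_eq_mul]
    rw [← mul_assoc, mul_one_div_cancel card_grid_ne_zero, one_mul]
  · intro v _ hv
    have : ∀ p, 1 / (Fintype.card (Grid Q M) : ℂ) * (f v i * gridChar v p) * gridChar w (-p) =
        1 / (Fintype.card (Grid Q M) : ℂ) * f v i * gridChar p (v - w) := fun p => by
      rw [sub_eq_add_neg, gridChar_add, gridChar_comm p v, gridChar_comm p (-w),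
        gridChar_neg_left]
      ring
    simp only [this, ← Finset.mul_sum, sum_gridChar_left, sub_eq_zero, hv, if_false, mul_zero]
  · simp

/-- Plancherel with a shift: only `F̂` is expanded over pixels; the remaining sum over `w` is
Fourier inversion of `G` at `p + p'`. -/
theorem sum_star_fourier_mul_fourier (F G : FeatureMap Q M k) (p : Grid Q M) (i j : Fin k) :
    ∑ w, star (fourier F w i) * fourier G w j * gridChar w p =
      (Fintype.card (Grid Q M) : ℂ) * ((∑ p', F p' i * G (p + p') j : ℝ) : ℂ) := by
  simp only [star_fourier, Finset.sum_mul]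
  rw [Finset.sum_comm]
  have : ∀ p' w, (F p' i : ℂ) * gridChar w p' * fourier G w j * gridChar w p =
      (F p' i : ℂ) * (fourier G w j * gridChar w (p + p')) := fun p' w => by
    rw [gridChar_add]; ring
  simp only [this, ← Finset.mul_sum, sum_fourier_mul_gridChar]
  push_cast
  rw [Finset.mul_sum]
  exact Finset.sum_congr rfl fun _ _ => by ring

theorem sum_star_fourier_mul_fourier_zero (F G : FeatureMap Q M k) (i : Fin k) :
    ∑ w, star (fourier F w i) * fourier G w i =
      (Fintype.card (Grid Q M) : ℂ) * ((∑ p, F p i * G p i : ℝ) : ℂ) := by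
  have h := sum_star_fourier_mul_fourier F G 0 i i
  simp only [gridChar_comm _ 0, gridChar_zero_left, mul_one, zero_add] at h
  exact h

theorem fourier_add (F G : FeatureMap Q M k) (w : Grid Q M) (i : Fin k) :
    fourier (F + G) w i = fourier F w i + fourier G w i := by
  simp [fourier, add_mul, Finset.sum_add_distrib]

theorem fourier_smul (c : ℝ) (F : FeatureMap Q M k) (w : Grid Q M) (i : Fin k) :
    fourier (c • F) w i = c * fourier F w i := by
  simp [fourier, mul_assoc, Finset.mul_sum]

/-! ### Cross-correlations, means and centering -/

/-- The matrix-valued correlation `(1/|U|) ∑ p', F(p',i) F(p+p',j)`. -/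
def crossCorrelation (F : FeatureMap Q M k) (p : Grid Q M) (i j : Fin k) : ℝ :=
  (1 / (Fintype.card (Grid Q M) : ℝ)) * ∑ p', F p' i * F (p + p') j

/-- Phase changes of the spectrum, common to all channels, preserve the correlations. -/
theorem crossCorrelation_eq_of_phase {F G : FeatureMap Q M k} {c : Grid Q M → ℂ}
    (hc : ∀ w, ‖c w‖ = 1) (h : ∀ w i, fourier G w i = fourier F w i * c w) :
    crossCorrelation G = crossCorrelation F := by
  funext p i j
  have h1 := sum_star_fourier_mul_fourier G G p i j
  have hcc : ∀ w, star (c w) * c w = 1 := fun w => by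
    rw [Complex.star_def, Complex.conj_mul', hc]; simp
  have h2 : ∀ w, star (fourier G w i) * fourier G w j * gridChar w p =
      star (fourier F w i) * fourier F w j * gridChar w p := fun w => by
    rw [h, h, star_mul']
    linear_combination star (fourier F w i) * fourier F w j * gridChar w p * hcc w
  simp only [h2, sum_star_fourier_mul_fourier F F p i j] at h1
  have h3 := mul_left_cancel₀ card_grid_ne_zero h1
  rw [crossCorrelation, crossCorrelation, Complex.ofReal_injective h3]

theorem gram_eq_crossCorrelation (F : FeatureMap Q M k) (i j : Fin k) :
    gram F i j = crossCorrelation F 0 i j := by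
  simp [gram, crossCorrelation]

theorem correlation_eq_crossCorrelation (F : FeatureMap Q M k) (p : Grid Q M) (n : Fin k) :
    correlation F p n = crossCorrelation F p n n := rfl

/-- The feature map with its mean removed. -/
def center (F : FeatureMap Q M k) : FeatureMap Q M k := fun p i => F p i - mean F i

theorem covariance_eq_crossCorrelation_center (F : FeatureMap Q M k) :
    covariance F = crossCorrelation (center F) := rfl

theorem sum_eq_card_mul_mean (F : FeatureMap Q M k) (i : Fin k) :
    ∑ p, F p i = (Fintype.card (Grid Q M) : ℝ) * mean F i := by
  have := (card_grid_pos (Q := Q) (M := M)).ne'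
  rw [mean]; field_simp

theorem fourier_zero_freq (F : FeatureMap Q M k) (i : Fin k) :
    fourier F 0 i = (Fintype.card (Grid Q M) : ℂ) * mean F i := by
  have := sum_eq_card_mul_mean F i
  simp only [fourier, gridChar_zero_left, mul_one]
  exact_mod_cast this

theorem crossCorrelation_eq_covariance_add (F : FeatureMap Q M k) (p : Grid Q M) (i j : Fin k) :
    crossCorrelation F p i j = covariance F p i j + mean F i * mean F j := by
  have hN := (card_grid_pos (Q := Q) (M := M)).ne'
  have h1 := sum_eq_card_mul_mean F i
  have h2 : ∑ p', F (p + p') j = (Fintype.card (Grid Q M) : ℝ) * mean F j := by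
    rw [← sum_eq_card_mul_mean]
    exact Fintype.sum_equiv (Equiv.addLeft p) _ _ fun _ => rfl
  simp only [covariance, crossCorrelation, sub_mul, mul_sub, Finset.sum_sub_distrib,
    ← Finset.mul_sum, ← Finset.sum_mul, h1, h2, Finset.sum_const, Finset.card_univ, nsmul_eq_mul]
  field_simp
  ring

theorem fourier_center (F : FeatureMap Q M k) (w : Grid Q M) (i : Fin k) :
    fourier (center F) w i = if w = 0 then 0 else fourier F w i := by
  have h : fourier (center F) w i =
      fourier F w i - mean F i * ∑ p : Grid Q M, gridChar p (-w) := by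
    simp only [fourier, center, Finset.mul_sum, ← Finset.sum_sub_distrib]
    refine Finset.sum_congr rfl fun p _ => ?_
    rw [gridChar_comm p, gridChar_neg_left]; push_cast; ring
  rw [h, sum_gridChar_left]
  split_ifs with h1 h2 h2
  · subst h2; rw [fourier_zero_freq]; ring
  · simp_all
  · simp_all
  · simp

theorem mean_add (F G : FeatureMap Q M k) (i : Fin k) : mean (F + G) i = mean F i + mean G i := by
  simp [mean, Finset.sum_add_distrib, mul_add]

theorem mean_smul (c : ℝ) (F : FeatureMap Q M k) (i : Fin k) : mean (c • F) i = c * mean F i := by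
  simp only [mean, Pi.smul_apply, smul_eq_mul, ← Finset.mul_sum]; ring

theorem center_add_smul (a b : ℝ) (F G : FeatureMap Q M k) :
    center (a • F + b • G) = a • center F + b • center G := by
  funext p i
  simp only [center, mean_add, mean_smul, Pi.add_apply, Pi.smul_apply, smul_eq_mul]; ring

/-! ### The mixed feature map -/

theorem norm_phase (z : ℂ) : ‖phase z‖ = 1 := by
  unfold phase
  split_ifs with h
  · simp
  · simp [h]

theorem phase_star (z : ℂ) : phase (star z) = star (phase z) := by
  unfold phase
  by_cases h : z = 0
  · simp [h]
  · simp [h]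

theorem norm_mul_phase (z : ℂ) : (‖z‖ : ℂ) * phase z = z := by
  unfold phase
  split_ifs with h
  · simp [h]
  · field_simp [Complex.ofReal_ne_zero.2 (norm_ne_zero_iff.2 h)]

theorem phase_ofReal_of_nonneg {r : ℝ} (hr : 0 ≤ r) : phase (r : ℂ) = 1 := by
  unfold phase
  split_ifs with h
  · rfl
  · rw [Complex.norm_real, Real.norm_of_nonneg hr, div_self h]

theorem crossSpectrum_neg (F₀ F₁ : FeatureMap Q M k) (w : Grid Q M) :
    crossSpectrum F₀ F₁ (-w) = star (crossSpectrum F₀ F₁ w) := by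
  simp only [crossSpectrum, fourier_neg, star_sum, star_mul']

theorem alignedFourier_neg (F₀ F₁ : FeatureMap Q M k) (w : Grid Q M) (i : Fin k) :
    alignedFourier F₀ F₁ (-w) i = star (alignedFourier F₀ F₁ w i) := by
  simp only [alignedFourier, crossSpectrum_neg, phase_star, fourier_neg, star_mul']

theorem fourier_mix (F₀ F₁ : FeatureMap Q M k) (ρ : ℝ) (w : Grid Q M) (i : Fin k) :
    fourier (mix F₀ F₁ ρ) w i =
      (1 - (ρ : ℂ)) * fourier F₀ w i + (ρ : ℂ) * alignedFourier F₀ F₁ w i := by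
  refine fourier_re_inverse
    (f := fun w i => (1 - (ρ : ℂ)) * fourier F₀ w i + (ρ : ℂ) * alignedFourier F₀ F₁ w i) ?_ w i
  intro w i
  simp [fourier_neg, alignedFourier_neg]

theorem fourier_mix_one (F₀ F₁ : FeatureMap Q M k) (w : Grid Q M) (i : Fin k) :
    fourier (mix F₀ F₁ 1) w i = fourier F₁ w i * phase (crossSpectrum F₀ F₁ w) := by
  simp [fourier_mix, alignedFourier]

/-- The Fourier formula is affine in `ρ`, so the mixed maps form the segment from `F₀` to the
phase-aligned version of `F₁`. -/
theorem mix_eq (F₀ F₁ : FeatureMap Q M k) (ρ : ℝ) :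
    mix F₀ F₁ ρ = (1 - ρ) • F₀ + ρ • mix F₀ F₁ 1 := by
  refine eq_of_fourier_eq fun w i => ?_
  rw [fourier_add, fourier_smul, fourier_smul, fourier_mix, fourier_mix_one, alignedFourier]
  push_cast; ring

theorem mix_zero (F₀ F₁ : FeatureMap Q M k) : mix F₀ F₁ 0 = F₀ := by
  rw [mix_eq]; simp

/-- The endpoint `mix F₀ F₁ 1` need not be `F₁`, but differs from it only by phases common to all
channels. -/
theorem crossCorrelation_mix_one (F₀ F₁ : FeatureMap Q M k) :
    crossCorrelation (mix F₀ F₁ 1) = crossCorrelation F₁ :=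
  crossCorrelation_eq_of_phase (fun _ => norm_phase _) (fourier_mix_one F₀ F₁)

/-- Centering commutes with phase alignment: both sides vanish at `w = 0`, and the other frequencies
are untouched by centering. -/
theorem fourier_center_mix_one (F₀ F₁ : FeatureMap Q M k) (w : Grid Q M) (i : Fin k) :
    fourier (center (mix F₀ F₁ 1)) w i =
      fourier (center F₁) w i * phase (crossSpectrum (center F₀) (center F₁) w) := by
  by_cases hw : w = 0 <;> simp [fourier_center, fourier_mix_one, crossSpectrum, hw]

/-- The cross spectrum at frequency `0` is `N² ⟨m₀, m₁⟩`, so its phase is `1` under the hypothesis;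
for a negative product it would be `-1`, and the mean would head for `-m₁`. -/
theorem mean_mix_of_nonneg {F₀ F₁ : FeatureMap Q M k} (h : 0 ≤ ∑ i, mean F₀ i * mean F₁ i)
    (ρ : ℝ) (i : Fin k) : mean (mix F₀ F₁ ρ) i = (1 - ρ) * mean F₀ i + ρ * mean F₁ i := by
  have hs : crossSpectrum F₀ F₁ 0 =
      (((Fintype.card (Grid Q M) : ℝ) ^ 2 * ∑ i, mean F₀ i * mean F₁ i : ℝ) : ℂ) := by
    simp only [crossSpectrum, fourier_zero_freq]
    push_cast
    rw [Finset.mul_sum]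
    refine Finset.sum_congr rfl fun i _ => ?_
    simp; ring
  have h1 := fourier_mix_one F₀ F₁ 0 i
  rw [hs, phase_ofReal_of_nonneg (by positivity), mul_one, fourier_zero_freq,
    fourier_zero_freq] at h1
  have h2 : mean (mix F₀ F₁ 1) i = mean F₁ i := by
    exact_mod_cast mul_left_cancel₀ card_grid_ne_zero h1
  rw [mix_eq, mean_add, mean_smul, mean_smul, h2]

/-! ### Optimality of couplings from dual potentials -/

section Duality

variable {E : Type*} [MeasurableSpace E]

theorem IsCoupling.measurePreserving_fst {π : Measure (E × E)} {μ ν : Measure E}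
    (h : IsCoupling π μ ν) : MeasurePreserving Prod.fst π μ := ⟨measurable_fst, h.1⟩

theorem IsCoupling.measurePreserving_snd {π : Measure (E × E)} {μ ν : Measure E}
    (h : IsCoupling π μ ν) : MeasurePreserving Prod.snd π ν := ⟨measurable_snd, h.2⟩

variable {μ ν : Measure E} {φ ψ : E → ℝ}

theorem IsCoupling.integrable_add (hφ : Integrable φ μ) (hψ : Integrable ψ ν)
    {π : Measure (E × E)} (h : IsCoupling π μ ν) :
    Integrable (fun z => φ z.1 + ψ z.2) π :=
  (h.measurePreserving_fst.integrable_comp_of_integrable hφ).add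
    (h.measurePreserving_snd.integrable_comp_of_integrable hψ)

theorem IsCoupling.integral_add (hφ : Integrable φ μ) (hψ : Integrable ψ ν)
    {π : Measure (E × E)} (h : IsCoupling π μ ν) :
    ∫ z, φ z.1 + ψ z.2 ∂π = ∫ x, φ x ∂μ + ∫ y, ψ y ∂ν := by
  rw [MeasureTheory.integral_add (f := fun z : E × E => φ z.1) (g := fun z : E × E => ψ z.2)
    (h.measurePreserving_fst.integrable_comp_of_integrable hφ)
    (h.measurePreserving_snd.integrable_comp_of_integrable hψ)]
  congr 1
  · rw [← h.1, integral_map measurable_fst.aemeasurable (by rw [h.1]; exact hφ.1)]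
  · rw [← h.2, integral_map measurable_snd.aemeasurable (by rw [h.2]; exact hψ.1)]

/-- A plan concentrated on the graph of `T` is the image of its first marginal. -/
theorem IsCoupling.eq_map_of_ae_eq {π : Measure (E × E)} (h : IsCoupling π μ ν) {T : E → E}
    (hT : Measurable T) (hae : ∀ᵐ z ∂π, z.2 = T z.1) : π = μ.map fun x => (x, T x) := by
  rw [← h.1, Measure.map_map (by fun_prop) measurable_fst]
  conv_lhs => rw [← Measure.map_id (μ := π)]
  refine Measure.map_congr ?_
  filter_upwards [hae] with z hz
  exact Prod.ext rfl hz

variable [NormedAddCommGroup E]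

theorem IsCoupling.integrable_norm_sq_sub (hμ : MemLp id 2 μ) (hν : MemLp id 2 ν)
    {π : Measure (E × E)} (h : IsCoupling π μ ν) :
    Integrable (fun z => ‖z.1 - z.2‖ ^ 2) π :=
  ((hμ.comp_measurePreserving h.measurePreserving_fst).sub
    (hν.comp_measurePreserving h.measurePreserving_snd)).integrable_norm_pow two_ne_zero

/-- Finite second moments turn comparisons of extended costs into comparisons of real integrals. -/
theorem IsCoupling.transportCost_eq (hμ : MemLp id 2 μ) (hν : MemLp id 2 ν)
    {π : Measure (E × E)} (h : IsCoupling π μ ν) :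
    transportCost π = ENNReal.ofReal (∫ z, ‖z.1 - z.2‖ ^ 2 ∂π) := by
  rw [ofReal_integral_eq_lintegral_ofReal (h.integrable_norm_sq_sub hμ hν)
    (ae_of_all _ fun _ => by positivity), transportCost]
  refine lintegral_congr fun z => ?_
  rw [ENNReal.ofReal_pow (norm_nonneg _), ofReal_norm]

/-- If the cost dominates `φ ⊕ ψ` on sets of full measure, then a coupling along which the two
are equal is optimal, and they are equal along every optimal coupling. -/
theorem isOptimalCoupling_of_potentials (hμ : MemLp id 2 μ) (hν : MemLp id 2 ν)
    (hφ : Integrable φ μ) (hψ : Integrable ψ ν) {P R : E → Prop} (hP : ∀ᵐ x ∂μ, P x)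
    (hR : ∀ᵐ y ∂ν, R y) (hle : ∀ x y, P x → R y → φ x + ψ y ≤ ‖x - y‖ ^ 2)
    {π : Measure (E × E)} (hπ : IsCoupling π μ ν)
    (heq : ∀ᵐ z ∂π, φ z.1 + ψ z.2 = ‖z.1 - z.2‖ ^ 2) :
    IsOptimalCoupling π μ ν ∧ ∀ π' : Measure (E × E), IsOptimalCoupling π' μ ν →
      ∀ᵐ z ∂π', φ z.1 + ψ z.2 = ‖z.1 - z.2‖ ^ 2 := by
  have hval : ∫ z, ‖z.1 - z.2‖ ^ 2 ∂π = ∫ x, φ x ∂μ + ∫ y, ψ y ∂ν := by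
    rw [← hπ.integral_add hφ hψ]; exact (integral_congr_ae heq).symm
  have hae : ∀ π' : Measure (E × E), IsCoupling π' μ ν →
      ∀ᵐ z ∂π', φ z.1 + ψ z.2 ≤ ‖z.1 - z.2‖ ^ 2 := fun π' h' => by
    filter_upwards [h'.measurePreserving_fst.quasiMeasurePreserving.ae hP,
      h'.measurePreserving_snd.quasiMeasurePreserving.ae hR] with z h1 h2 using hle _ _ h1 h2
  have hmono : ∀ π' : Measure (E × E), IsCoupling π' μ ν →
      ∫ x, φ x ∂μ + ∫ y, ψ y ∂ν ≤ ∫ z, ‖z.1 - z.2‖ ^ 2 ∂π' := fun π' h' => by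
    rw [← h'.integral_add hφ hψ]
    exact integral_mono_ae (h'.integrable_add hφ hψ) (h'.integrable_norm_sq_sub hμ hν) (hae π' h')
  refine ⟨⟨hπ, fun π' h' => ?_⟩, fun π' h' => ?_⟩
  · rw [hπ.transportCost_eq hμ hν, h'.transportCost_eq hμ hν, hval]
    exact ENNReal.ofReal_le_ofReal (hmono π' h')
  · have h1 := h'.2 π hπ
    rw [hπ.transportCost_eq hμ hν, h'.1.transportCost_eq hμ hν,
      ENNReal.ofReal_le_ofReal_iff (integral_nonneg fun _ => by positivity), hval] at h1
    refine (integral_eq_iff_of_ae_le (h'.1.integrable_add hφ hψ)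
      (h'.1.integrable_norm_sq_sub hμ hν) (hae π' h'.1)).1 ?_
    rw [h'.1.integral_add hφ hψ]
    exact le_antisymm (hmono π' h'.1) h1

end Duality

/-! ### Gaussian laws as images of white noise -/

open Matrix in
-- Compared through characteristic functions: `⟨B ξ, t⟩ = ⟨ξ, Bᵀ t⟩` and `‖Bᵀ t‖² = ⟨t, B Bᵀ t⟩`.
-- Degenerate covariances are allowed.
theorem map_stdGaussian_mulVec {ι κ : Type*} [Fintype ι] [Fintype κ] [DecidableEq ι]
    (m : EuclideanSpace ℝ ι) (B : Matrix ι κ ℝ) :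
    (stdGaussian (EuclideanSpace ℝ κ)).map (fun ξ => m + WithLp.toLp 2 (B *ᵥ ξ.ofLp)) =
      multivariateGaussian m (B * Bᵀ) := by
  have hmeas : Measurable fun ξ : EuclideanSpace ℝ κ => m + WithLp.toLp 2 (B *ᵥ ξ.ofLp) := by
    have : Continuous fun ξ : EuclideanSpace ℝ κ => m + WithLp.toLp 2 (B *ᵥ ξ.ofLp) := by
      fun_prop
    exact this.measurable
  have hS : (B * Bᵀ).PosSemidef := by
    simpa using posSemidef_self_mul_conjTranspose B
  have : IsProbabilityMeasure
      ((stdGaussian (EuclideanSpace ℝ κ)).map (fun ξ => m + WithLp.toLp 2 (B *ᵥ ξ.ofLp))) :=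
    Measure.isProbabilityMeasure_map hmeas.aemeasurable
  refine Measure.ext_of_charFun (funext fun t => ?_)
  rw [charFun_multivariateGaussian hS, charFun_apply, integral_map hmeas.aemeasurable
    (Measurable.aestronglyMeasurable (by fun_prop))]
  have hinner : ∀ ξ : EuclideanSpace ℝ κ, inner ℝ (m + WithLp.toLp 2 (B *ᵥ ξ.ofLp)) t =
      inner ℝ t m + inner ℝ ξ (WithLp.toLp 2 (Bᵀ *ᵥ t.ofLp)) := fun ξ => by
    rw [inner_add_left, real_inner_comm]
    congr 1
    simp only [EuclideanSpace.inner_eq_star_dotProduct, star_trivial]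
    rw [dotProduct_mulVec, mulVec_transpose]
  simp only [hinner, Complex.ofReal_add, add_mul, Complex.exp_add]
  rw [integral_const_mul, ← charFun_apply, charFun_stdGaussian, ← Complex.exp_add]
  congr 1
  rw [sub_eq_add_neg, neg_div]
  congr 3
  rw [← Complex.ofReal_pow, ← real_inner_self_eq_norm_sq]
  congr 1
  simp only [EuclideanSpace.inner_eq_star_dotProduct, star_trivial]
  rw [← mulVec_mulVec, dotProduct_mulVec t.ofLp, mulVec_transpose]

/-- The filter of white noise by a feature map, as a matrix. -/
def filterMatrix (H : FeatureMap Q M k) : Matrix (Grid Q M × Fin k) (Grid Q M) ℝ :=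
  Matrix.of fun a q => H (a.1 + q) a.2 / √(Fintype.card (Grid Q M))

/-- White noise `ξ` filtered by the feature map `H`, with mean `m`. -/
def synthesis (m : Fin k → ℝ) (H : FeatureMap Q M k) (ξ : EuclideanSpace ℝ (Grid Q M)) :
    Field Q M k :=
  WithLp.toLp 2 (fun a => m a.2) + WithLp.toLp 2 ((filterMatrix H).mulVec ξ.ofLp)

theorem synthesis_apply (m : Fin k → ℝ) (H : FeatureMap Q M k) (ξ : EuclideanSpace ℝ (Grid Q M))
    (p : Grid Q M) (i : Fin k) :
    synthesis m H ξ (p, i) =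
      m i + ∑ q, H (p + q) i / √(Fintype.card (Grid Q M)) * ξ q := rfl

theorem continuous_synthesis (m : Fin k → ℝ) (H : FeatureMap Q M k) :
    Continuous (synthesis m H) := by
  unfold synthesis; fun_prop

theorem measurable_synthesis (m : Fin k → ℝ) (H : FeatureMap Q M k) :
    Measurable (synthesis m H) := (continuous_synthesis m H).measurable

theorem filterMatrix_mul_transpose (H : FeatureMap Q M k) :
    filterMatrix H * (filterMatrix H).transpose =
      Matrix.of fun a b => crossCorrelation H (b.1 - a.1) a.2 b.2 := by
  ext a b
  have hN := Real.mul_self_sqrt (card_grid_pos (Q := Q) (M := M)).le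
  simp only [Matrix.mul_apply, Matrix.transpose_apply, filterMatrix, Matrix.of_apply,
    crossCorrelation, Finset.mul_sum]
  -- Substitution `p' = a.1 + q`, under which `b.1 - a.1 + p' = b.1 + q`.
  refine Fintype.sum_equiv (Equiv.addLeft a.1) _ _ fun q => ?_
  rw [Equiv.coe_addLeft, div_mul_div_comm, hN, ← add_assoc, sub_add_cancel]
  ring

theorem posSemidef_crossCorrelation (H : FeatureMap Q M k) :
    (Matrix.of fun a b : Grid Q M × Fin k =>
      crossCorrelation H (b.1 - a.1) a.2 b.2).PosSemidef := by
  rw [← filterMatrix_mul_transpose]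
  simpa using Matrix.posSemidef_self_mul_conjTranspose (filterMatrix H)

theorem map_synthesis (m : Fin k → ℝ) (H : FeatureMap Q M k) :
    (stdGaussian (EuclideanSpace ℝ (Grid Q M))).map (synthesis m H) =
      gaussianModel m (crossCorrelation H) := by
  rw [gaussianModel, ← filterMatrix_mul_transpose, ← map_stdGaussian_mulVec]; rfl

theorem synthesis_interpolate (m₀ m₁ : Fin k → ℝ) (H₀ H₁ : FeatureMap Q M k) (ρ : ℝ)
    (ξ : EuclideanSpace ℝ (Grid Q M)) :
    (1 - ρ) • synthesis m₀ H₀ ξ + ρ • synthesis m₁ H₁ ξ =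
      synthesis (fun i => (1 - ρ) * m₀ i + ρ * m₁ i) ((1 - ρ) • H₀ + ρ • H₁) ξ := by
  ext ⟨p, i⟩
  simp only [PiLp.add_apply, PiLp.smul_apply, smul_eq_mul, synthesis_apply, Pi.add_apply,
    Pi.smul_apply, mul_add, Finset.mul_sum, add_div, add_mul, Finset.sum_add_distrib]
  have h : ∀ (c : ℝ) (H : FeatureMap Q M k),
      ∑ q, c * (H (p + q) i / √(Fintype.card (Grid Q M)) * ξ q) =
      ∑ q, c * H (p + q) i / √(Fintype.card (Grid Q M)) * ξ q := fun c H =>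
    Finset.sum_congr rfl fun q _ => by ring
  rw [h, h]; ring

instance isGaussian_gaussianModel (m : Fin k → ℝ) (C : Grid Q M → Fin k → Fin k → ℝ) :
    IsGaussian (gaussianModel m C) := by
  unfold gaussianModel; infer_instance

theorem lawMean_gaussianModel (m : Fin k → ℝ) (C : Grid Q M → Fin k → Fin k → ℝ) (i : Fin k) :
    lawMean (gaussianModel m C) i = m i := by
  have h := (EuclideanSpace.proj ((0 : Grid Q M), i) : Field Q M k →L[ℝ] ℝ).integral_comp_comm
    (IsGaussian.integrable_id (μ := gaussianModel m C))
  refine h.trans ?_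
  simp only [id_eq]
  rw [gaussianModel, integral_id_multivariateGaussian]
  rfl

theorem lawCovariance_gaussianModel (m : Fin k → ℝ) (H : FeatureMap Q M k) (p : Grid Q M)
    (i j : Fin k) :
    lawCovariance (gaussianModel m (crossCorrelation H)) p i j = crossCorrelation H p i j := by
  rw [lawCovariance, gaussianModel,
    covariance_eval_multivariateGaussian (posSemidef_crossCorrelation H)]
  simp

theorem lawGram_modelOf (F : FeatureMap Q M k) (i j : Fin k) :
    lawGram (modelOf F) i j = gram F i j := by
  rw [lawGram, modelOf, lawMean_gaussianModel, lawMean_gaussianModel,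
    covariance_eq_crossCorrelation_center, lawCovariance_gaussianModel, gram_eq_crossCorrelation,
    crossCorrelation_eq_covariance_add F]
  rfl

theorem lawCorrelation_modelOf (F : FeatureMap Q M k) (p : Grid Q M) (n : Fin k) :
    lawCorrelation (modelOf F) p n = correlation F p n := by
  rw [lawCorrelation, modelOf, lawMean_gaussianModel,
    covariance_eq_crossCorrelation_center, lawCovariance_gaussianModel,
    correlation_eq_crossCorrelation, crossCorrelation_eq_covariance_add F]
  rfl

/-! ### Spectra of fields with rank-one spectral density -/

/-- The Fourier transform of the field `x` with the mean `m` removed. -/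
def fieldSpectrum (m : Fin k → ℝ) (x : Field Q M k) (w : Grid Q M) (i : Fin k) : ℂ :=
  fourier (fun p i => x (p, i) - m i) w i

/-- The convolution theorem: the noise enters only through a scalar amplitude, the same for all
channels. This is the rank-one structure on which the transport argument rests. -/
theorem fieldSpectrum_synthesis (m : Fin k → ℝ) (H : FeatureMap Q M k)
    (ξ : EuclideanSpace ℝ (Grid Q M)) (w : Grid Q M) (i : Fin k) :
    fieldSpectrum m (synthesis m H ξ) w i =
      (∑ q, ((ξ q / √(Fintype.card (Grid Q M)) : ℝ) : ℂ) * gridChar w q) * fourier H w i := by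
  simp only [fieldSpectrum, fourier, synthesis_apply, add_sub_cancel_left]
  push_cast
  simp only [Finset.sum_mul]
  rw [Finset.sum_comm]
  refine Finset.sum_congr rfl fun q _ => ?_
  rw [Finset.mul_sum]
  refine Fintype.sum_equiv (Equiv.addRight q) _ _ fun p => ?_
  have h : gridChar w (-p) = gridChar w q * gridChar w (-(p + q)) := by
    rw [← gridChar_add]; congr 1; abel
  rw [Equiv.coe_addRight, h]
  ring

theorem continuous_fieldSpectrum (m : Fin k → ℝ) (w : Grid Q M) (i : Fin k) :
    Continuous fun x : Field Q M k => fieldSpectrum m x w i := by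
  unfold fieldSpectrum fourier; fun_prop

theorem memLp_fieldSpectrum {μ : Measure (Field Q M k)} [IsFiniteMeasure μ] (hμ : MemLp id 2 μ)
    (m : Fin k → ℝ) (w : Grid Q M) (i : Fin k) :
    MemLp (fun x => fieldSpectrum m x w i) 2 μ := by
  unfold fieldSpectrum fourier
  refine memLp_finsetSum _ fun p _ => ?_
  have h : MemLp (fun x : Field Q M k => x (p, i) - m i) 2 μ :=
    ((EuclideanSpace.proj (p, i) : Field Q M k →L[ℝ] ℝ).comp_memLp' hμ).sub (memLp_const _)
  exact (h.ofReal (K := ℂ)).mul_const _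

/-- The spectral energy `∑ i, |F̂(w, i)|²`. -/
def energy (F : FeatureMap Q M k) (w : Grid Q M) : ℝ := ∑ i, ‖fourier F w i‖ ^ 2

theorem fourier_eq_zero_of_energy {F : FeatureMap Q M k} {w : Grid Q M} (h : energy F w = 0)
    (i : Fin k) : fourier F w i = 0 := by
  have := (Finset.sum_eq_zero_iff_of_nonneg (fun _ _ => by positivity)).1 h i (Finset.mem_univ i)
  simpa using this

/-- If the energy vanishes then so does the cross spectrum, so the convention `x / 0 = 0` does no
harm. -/
theorem norm_crossSpectrum_div_energy_left (F₀ F₁ : FeatureMap Q M k) (w : Grid Q M) :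
    ‖crossSpectrum F₀ F₁ w‖ / energy F₀ w * energy F₀ w = ‖crossSpectrum F₀ F₁ w‖ := by
  by_cases h : energy F₀ w = 0
  · simp [crossSpectrum, fourier_eq_zero_of_energy h]
  · rw [div_mul_cancel₀ _ h]

theorem norm_crossSpectrum_div_energy_right (F₀ F₁ : FeatureMap Q M k) (w : Grid Q M) :
    ‖crossSpectrum F₀ F₁ w‖ / energy F₁ w * energy F₁ w = ‖crossSpectrum F₀ F₁ w‖ := by
  by_cases h : energy F₁ w = 0
  · simp [crossSpectrum, fourier_eq_zero_of_energy h]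
  · rw [div_mul_cancel₀ _ h]

/-- The quadratic Kantorovich potential with spectral weights `κ`. -/
def potential (m m' : Fin k → ℝ) (κ : Grid Q M → ℝ) (x : Field Q M k) : ℝ :=
  ∑ a : Grid Q M × Fin k, ((x a - m a.2) ^ 2 + (m a.2 - m' a.2) ^ 2 / 2 +
    2 * (m a.2 - m' a.2) * (x a - m a.2)) -
  1 / (Fintype.card (Grid Q M) : ℝ) * ∑ w, κ w * ∑ i, ‖fieldSpectrum m x w i‖ ^ 2

theorem integrable_potential {μ : Measure (Field Q M k)} [IsFiniteMeasure μ] (hμ : MemLp id 2 μ)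
    (m m' : Fin k → ℝ) (κ : Grid Q M → ℝ) : Integrable (potential m m' κ) μ := by
  unfold potential
  refine Integrable.sub (integrable_finsetSum _ fun a _ => ?_)
    (Integrable.const_mul (integrable_finsetSum _ fun w _ =>
      Integrable.const_mul (integrable_finsetSum _ fun i _ => ?_) _) _)
  · have h : MemLp (fun x : Field Q M k => x a - m a.2) 2 μ :=
      ((EuclideanSpace.proj a : Field Q M k →L[ℝ] ℝ).comp_memLp' hμ).sub (memLp_const _)
    exact (h.integrable_sq.add (integrable_const _)).add
      ((h.integrable one_le_two).const_mul _)
  · exact (memLp_fieldSpectrum hμ m w i).integrable_norm_pow two_ne_zero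

theorem sum_fieldSpectrum_mul (m₀ m₁ : Fin k → ℝ) (x y : Field Q M k) :
    ∑ a : Grid Q M × Fin k, (x a - m₀ a.2) * (y a - m₁ a.2) =
      1 / (Fintype.card (Grid Q M) : ℝ) *
        ∑ w, (∑ i, star (fieldSpectrum m₁ y w i) * fieldSpectrum m₀ x w i).re := by
  have hN := (card_grid_pos (Q := Q) (M := M)).ne'
  have h : ∑ w, ∑ i, star (fieldSpectrum m₁ y w i) * fieldSpectrum m₀ x w i =
      (((Fintype.card (Grid Q M) : ℝ) *
        ∑ a : Grid Q M × Fin k, (x a - m₀ a.2) * (y a - m₁ a.2) : ℝ) : ℂ) := by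
    rw [Finset.sum_comm]
    simp only [fieldSpectrum, sum_star_fourier_mul_fourier_zero]
    rw [← Finset.mul_sum, Fintype.sum_prod_type, Finset.sum_comm]
    push_cast
    simp only [mul_comm]
  rw [← Complex.re_sum, h, Complex.ofReal_re]
  field_simp

/-- With `u = x - m₀` and `v = y - m₁`, every term of `‖x - y‖²` except `-2⟨u, v⟩` is absorbed by
one of the potentials. Plancherel moves the rest to frequencies, where the weights `|c| / energy`
are chosen to produce `|c| (|a|² + |b|²)`; with `c = |c| phase c` this completes the square. -/
theorem norm_sq_sub_sub_potential {m₀ m₁ : Fin k → ℝ} {H₀ H₁ : FeatureMap Q M k}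
    {x y : Field Q M k} {a b : Grid Q M → ℂ}
    (hx : ∀ w i, fieldSpectrum m₀ x w i = a w * fourier H₀ w i)
    (hy : ∀ w i, fieldSpectrum m₁ y w i = b w * fourier H₁ w i) :
    ‖x - y‖ ^ 2 -
      (potential m₀ m₁ (fun w => ‖crossSpectrum H₀ H₁ w‖ / energy H₀ w) x +
        potential m₁ m₀ (fun w => ‖crossSpectrum H₀ H₁ w‖ / energy H₁ w) y) =
    1 / (Fintype.card (Grid Q M) : ℝ) * ∑ w, ‖crossSpectrum H₀ H₁ w‖ *
      ‖a w * phase (crossSpectrum H₀ H₁ w) - b w‖ ^ 2 := by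
  have hsq : ‖x - y‖ ^ 2 = ∑ a : Grid Q M × Fin k, ((x a - m₀ a.2) ^ 2 +
        (m₀ a.2 - m₁ a.2) ^ 2 / 2 + 2 * (m₀ a.2 - m₁ a.2) * (x a - m₀ a.2)) +
      ∑ a : Grid Q M × Fin k, ((y a - m₁ a.2) ^ 2 +
        (m₁ a.2 - m₀ a.2) ^ 2 / 2 + 2 * (m₁ a.2 - m₀ a.2) * (y a - m₁ a.2)) -
      2 * ∑ a : Grid Q M × Fin k, (x a - m₀ a.2) * (y a - m₁ a.2) := by
    rw [EuclideanSpace.real_norm_sq_eq, Finset.mul_sum, ← Finset.sum_add_distrib,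
      ← Finset.sum_sub_distrib]
    refine Finset.sum_congr rfl fun a _ => ?_
    rw [PiLp.sub_apply]; ring
  have hgap : ∀ w, ‖crossSpectrum H₀ H₁ w‖ *
        ‖a w * phase (crossSpectrum H₀ H₁ w) - b w‖ ^ 2 =
      ‖crossSpectrum H₀ H₁ w‖ / energy H₀ w * ∑ i, ‖fieldSpectrum m₀ x w i‖ ^ 2 +
      ‖crossSpectrum H₀ H₁ w‖ / energy H₁ w * ∑ i, ‖fieldSpectrum m₁ y w i‖ ^ 2 -
      2 * (∑ i, star (fieldSpectrum m₁ y w i) * fieldSpectrum m₀ x w i).re := by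
    intro w
    have h1 : ∑ i, ‖fieldSpectrum m₀ x w i‖ ^ 2 = ‖a w‖ ^ 2 * energy H₀ w := by
      simp only [hx, norm_mul, mul_pow, energy, Finset.mul_sum]
    have h2 : ∑ i, ‖fieldSpectrum m₁ y w i‖ ^ 2 = ‖b w‖ ^ 2 * energy H₁ w := by
      simp only [hy, norm_mul, mul_pow, energy, Finset.mul_sum]
    have h3 : ∑ i, star (fieldSpectrum m₁ y w i) * fieldSpectrum m₀ x w i =
        star (b w) * a w * crossSpectrum H₀ H₁ w := by
      simp only [hx, hy, crossSpectrum, Finset.mul_sum, star_mul']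
      exact Finset.sum_congr rfl fun _ _ => by ring
    have h4 : star (b w) * a w * crossSpectrum H₀ H₁ w = (‖crossSpectrum H₀ H₁ w‖ : ℂ) *
        (a w * phase (crossSpectrum H₀ H₁ w) * star (b w)) := by
      conv_lhs => rw [← norm_mul_phase (crossSpectrum H₀ H₁ w)]
      ring
    have h5 : ‖a w * phase (crossSpectrum H₀ H₁ w) - b w‖ ^ 2 = ‖a w‖ ^ 2 + ‖b w‖ ^ 2 -
        2 * (a w * phase (crossSpectrum H₀ H₁ w) * star (b w)).re := by
      rw [Complex.sq_norm, Complex.normSq_sub, ← Complex.sq_norm, ← Complex.sq_norm, norm_mul,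
        norm_phase, mul_one]
      rfl
    rw [h1, h2, h3, h4, h5, Complex.re_ofReal_mul]
    linear_combination (-‖a w‖ ^ 2) * norm_crossSpectrum_div_energy_left H₀ H₁ w -
      ‖b w‖ ^ 2 * norm_crossSpectrum_div_energy_right H₀ H₁ w
  simp only [hgap, Finset.sum_sub_distrib, Finset.sum_add_distrib, ← Finset.mul_sum]
  rw [hsq, sum_fieldSpectrum_mul, potential, potential]
  ring

/-- The optimal transport map between two stationary Gaussian models. -/
def transportMap (m₀ m₁ : Fin k → ℝ) (H₀ H₁ : FeatureMap Q M k) (x : Field Q M k) :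
    Field Q M k :=
  WithLp.toLp 2 fun c => m₁ c.2 + ((1 / (Fintype.card (Grid Q M) : ℂ)) *
    ∑ w, (∑ j, star (fourier H₀ w j) * fieldSpectrum m₀ x w j) / (energy H₀ w : ℂ) *
      phase (crossSpectrum H₀ H₁ w) * fourier H₁ w c.2 * gridChar w c.1).re

theorem measurable_transportMap (m₀ m₁ : Fin k → ℝ) (H₀ H₁ : FeatureMap Q M k) :
    Measurable (transportMap m₀ m₁ H₀ H₁) := by
  have h := continuous_fieldSpectrum (Q := Q) (M := M) m₀
  refine Continuous.measurable ?_
  unfold transportMap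
  fun_prop

/-- Equality makes a sum of nonnegative terms vanish, so `b = a · phase c` wherever `c ≠ 0`; where
`c = 0`, the hypothesis `hs` makes the spectrum of `y` zero. Fourier inversion then recovers `y`. -/
theorem eq_transportMap {m₀ m₁ : Fin k → ℝ} {H₀ H₁ : FeatureMap Q M k}
    (hs : ∀ w, crossSpectrum H₀ H₁ w = 0 → ∀ i, fourier H₁ w i = 0)
    {x y : Field Q M k} {a b : Grid Q M → ℂ}
    (hx : ∀ w i, fieldSpectrum m₀ x w i = a w * fourier H₀ w i)
    (hy : ∀ w i, fieldSpectrum m₁ y w i = b w * fourier H₁ w i)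
    (hxy : potential m₀ m₁ (fun w => ‖crossSpectrum H₀ H₁ w‖ / energy H₀ w) x +
        potential m₁ m₀ (fun w => ‖crossSpectrum H₀ H₁ w‖ / energy H₁ w) y = ‖x - y‖ ^ 2) :
    y = transportMap m₀ m₁ H₀ H₁ x := by
  have hgap := norm_sq_sub_sub_potential hx hy
  rw [hxy, sub_self, eq_comm, mul_eq_zero] at hgap
  replace hgap := hgap.resolve_left (one_div_pos.2 card_grid_pos).ne'
  rw [Finset.sum_eq_zero_iff_of_nonneg fun _ _ => by positivity] at hgap
  have hspec : ∀ w i, (∑ j, star (fourier H₀ w j) * fieldSpectrum m₀ x w j) /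
      (energy H₀ w : ℂ) * phase (crossSpectrum H₀ H₁ w) * fourier H₁ w i =
      fieldSpectrum m₁ y w i := by
    intro w i
    by_cases h0 : crossSpectrum H₀ H₁ w = 0
    · rw [hy, hs w h0]; simp
    · have h1 := (mul_eq_zero.1 (hgap w (Finset.mem_univ w))).resolve_left (norm_ne_zero_iff.2 h0)
      have hb : a w * phase (crossSpectrum H₀ H₁ w) = b w := by
        simpa [sub_eq_zero] using h1
      have he : energy H₀ w ≠ 0 := fun he => h0 <| by
        simp [crossSpectrum, fourier_eq_zero_of_energy he]
      -- Projecting the spectrum of `x` onto `Ĥ₀` reads off the amplitude `a w`.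
      have ha : ∑ j, star (fourier H₀ w j) * fieldSpectrum m₀ x w j = a w * energy H₀ w := by
        simp only [hx, energy, Complex.ofReal_sum, Finset.mul_sum, Complex.ofReal_pow]
        refine Finset.sum_congr rfl fun j _ => ?_
        rw [← Complex.conj_mul', ← Complex.star_def]; ring
      rw [ha, mul_div_cancel_right₀ _ (Complex.ofReal_ne_zero.2 he), hb, hy]
  ext ⟨p, i⟩
  simp only [transportMap, hspec]
  simp only [fieldSpectrum, sum_fourier_mul_gridChar]
  rw [← mul_assoc, one_div_mul_cancel card_grid_ne_zero, one_mul, Complex.ofReal_re]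
  ring

/-! ### Optimal couplings of stationary Gaussian models -/

/-- The coupling of two filtered noises driven by the same white noise. -/
def synthesisCoupling (m₀ m₁ : Fin k → ℝ) (H₀ H₁ : FeatureMap Q M k) :
    Measure (Field Q M k × Field Q M k) :=
  (stdGaussian (EuclideanSpace ℝ (Grid Q M))).map fun ξ =>
    (synthesis m₀ H₀ ξ, synthesis m₁ H₁ ξ)

theorem isCoupling_synthesisCoupling (m₀ m₁ : Fin k → ℝ) (H₀ H₁ : FeatureMap Q M k) :
    IsCoupling (synthesisCoupling m₀ m₁ H₀ H₁) (gaussianModel m₀ (crossCorrelation H₀))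
      (gaussianModel m₁ (crossCorrelation H₁)) := by
  have h₀ := measurable_synthesis m₀ H₀
  have h₁ := measurable_synthesis m₁ H₁
  constructor
  · rw [synthesisCoupling, Measure.map_map measurable_fst (by fun_prop), ← map_synthesis]; rfl
  · rw [synthesisCoupling, Measure.map_map measurable_snd (by fun_prop), ← map_synthesis]; rfl

theorem map_interpolate_synthesisCoupling (m₀ m₁ : Fin k → ℝ) (H₀ H₁ : FeatureMap Q M k)
    (ρ : ℝ) :
    (synthesisCoupling m₀ m₁ H₀ H₁).map (fun z => (1 - ρ) • z.1 + ρ • z.2) =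
      gaussianModel (fun i => (1 - ρ) * m₀ i + ρ * m₁ i)
        (crossCorrelation ((1 - ρ) • H₀ + ρ • H₁)) := by
  have h₀ := measurable_synthesis m₀ H₀
  have h₁ := measurable_synthesis m₁ H₁
  rw [synthesisCoupling, Measure.map_map (by fun_prop) (by fun_prop), ← map_synthesis]
  exact congrArg (fun f => Measure.map f _) (funext fun ξ => synthesis_interpolate m₀ m₁ H₀ H₁ ρ ξ)

theorem ae_exists_fieldSpectrum_eq (m : Fin k → ℝ) (H : FeatureMap Q M k) :
    ∀ᵐ x ∂gaussianModel m (crossCorrelation H), ∃ a : Grid Q M → ℂ,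
      ∀ w i, fieldSpectrum m x w i = a w * fourier H w i := by
  -- The amplitude is given explicitly by projection onto `Ĥ`, so that the event is an equality of
  -- continuous functions, hence measurable, and can be pulled back to the noise.
  have key : ∀ᵐ x ∂gaussianModel m (crossCorrelation H), ∀ w i, fieldSpectrum m x w i =
      (∑ j, star (fourier H w j) * fieldSpectrum m x w j) / (energy H w : ℂ) * fourier H w i := by
    have hc := continuous_fieldSpectrum (Q := Q) (M := M) m
    refine ae_all_iff.2 fun w => ae_all_iff.2 fun i => ?_
    rw [← map_synthesis, ae_map_iff (measurable_synthesis m H).aemeasurable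
      (measurableSet_eq_fun (hc w i).measurable (Continuous.measurable (by fun_prop)))]
    refine ae_of_all _ fun ξ => ?_
    by_cases he : energy H w = 0
    · simp [fieldSpectrum_synthesis, fourier_eq_zero_of_energy he]
    · rw [eq_comm, div_mul_eq_mul_div, div_eq_iff (Complex.ofReal_ne_zero.2 he)]
      simp only [fieldSpectrum_synthesis]
      generalize ∑ q, ((ξ q / √(Fintype.card (Grid Q M)) : ℝ) : ℂ) * gridChar w q = a
      simp only [energy, Complex.ofReal_sum, Finset.mul_sum, Finset.sum_mul, Complex.ofReal_pow]
      refine Finset.sum_congr rfl fun j _ => ?_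
      rw [← Complex.conj_mul', ← Complex.star_def]
      ring
  filter_upwards [key] with x hx using ⟨_, hx⟩

/-- Two filtered noises driven by the same white noise, with filters whose spectra are in phase,
are optimally coupled, and uniquely so if the spectra overlap at all frequencies. -/
theorem isOptimalCoupling_synthesisCoupling (m₀ m₁ : Fin k → ℝ) {H₀ H₁ G : FeatureMap Q M k}
    (hG : ∀ w i, fourier G w i = fourier H₁ w i * phase (crossSpectrum H₀ H₁ w)) :
    IsOptimalCoupling (synthesisCoupling m₀ m₁ H₀ G) (gaussianModel m₀ (crossCorrelation H₀))
      (gaussianModel m₁ (crossCorrelation H₁)) ∧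
    ((∀ w, crossSpectrum H₀ H₁ w = 0 → ∀ i, fourier H₁ w i = 0) →
      ∀ π, IsOptimalCoupling π (gaussianModel m₀ (crossCorrelation H₀))
        (gaussianModel m₁ (crossCorrelation H₁)) → π = synthesisCoupling m₀ m₁ H₀ G) := by
  have hcoup := isCoupling_synthesisCoupling m₀ m₁ H₀ G
  rw [crossCorrelation_eq_of_phase (fun _ => norm_phase _) hG] at hcoup
  have hμ := IsGaussian.memLp_two_id (μ := gaussianModel m₀ (crossCorrelation H₀))
  have hν := IsGaussian.memLp_two_id (μ := gaussianModel m₁ (crossCorrelation H₁))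
  have hP := ae_exists_fieldSpectrum_eq m₀ H₀
  have hR := ae_exists_fieldSpectrum_eq m₁ H₁
  have hφ := integrable_potential hμ m₀ m₁ fun w => ‖crossSpectrum H₀ H₁ w‖ / energy H₀ w
  have hψ := integrable_potential hν m₁ m₀ fun w => ‖crossSpectrum H₀ H₁ w‖ / energy H₁ w
  have heq : ∀ᵐ z ∂synthesisCoupling m₀ m₁ H₀ G,
      potential m₀ m₁ (fun w => ‖crossSpectrum H₀ H₁ w‖ / energy H₀ w) z.1 +
        potential m₁ m₀ (fun w => ‖crossSpectrum H₀ H₁ w‖ / energy H₁ w) z.2 =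
      ‖z.1 - z.2‖ ^ 2 := by
    have h₀ := measurable_synthesis m₀ H₀
    have h₁ := measurable_synthesis m₁ G
    have hc := continuous_fieldSpectrum (Q := Q) (M := M) (k := k)
    rw [synthesisCoupling, ae_map_iff (by fun_prop) (measurableSet_eq_fun
      (Continuous.measurable (by unfold potential; fun_prop)) (by fun_prop))]
    refine ae_of_all _ fun ξ => ?_
    -- The common noise gives `b = a · phase c`, so every term of the gap is zero.
    have hgap := norm_sq_sub_sub_potential (m₁ := m₁) (H₁ := H₁) (y := synthesis m₁ G ξ)
      (fieldSpectrum_synthesis m₀ H₀ ξ) (b := fun w =>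
        (∑ q, ((ξ q / √(Fintype.card (Grid Q M)) : ℝ) : ℂ) * gridChar w q) *
          phase (crossSpectrum H₀ H₁ w)) (fun w i => by
        rw [fieldSpectrum_synthesis, hG]; ring)
    simp only [sub_self, norm_zero, ne_eq, OfNat.ofNat_ne_zero, not_false_eq_true, zero_pow,
      mul_zero, Finset.sum_const_zero] at hgap
    exact (sub_eq_zero.1 hgap).symm
  obtain ⟨hopt, huniq⟩ := isOptimalCoupling_of_potentials hμ hν hφ hψ hP hR
    (fun x y ⟨a, ha⟩ ⟨b, hb⟩ => by
      rw [← sub_nonneg, norm_sq_sub_sub_potential ha hb]; positivity) hcoup heq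
  refine ⟨hopt, fun hs π hπ => ?_⟩
  -- Both `π` and the common-noise coupling are optimal, hence carried by the graph of the same map,
  -- which with the first marginal determines them.
  have hgraph : ∀ π', IsOptimalCoupling π' (gaussianModel m₀ (crossCorrelation H₀))
      (gaussianModel m₁ (crossCorrelation H₁)) →
      π' = (gaussianModel m₀ (crossCorrelation H₀)).map
        fun x => (x, transportMap m₀ m₁ H₀ H₁ x) := fun π' h' => by
    refine h'.1.eq_map_of_ae_eq (measurable_transportMap m₀ m₁ H₀ H₁) ?_
    filter_upwards [huniq π' h', h'.1.measurePreserving_fst.quasiMeasurePreserving.ae hP,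
      h'.1.measurePreserving_snd.quasiMeasurePreserving.ae hR] with z hz ⟨a, ha⟩ ⟨b, hb⟩
    exact eq_transportMap hs ha hb hz
  rw [hgraph π hπ, hgraph _ hopt]

/-! ### Interpolation between the models of two feature maps -/

theorem map_interpolate_mix (F₀ F₁ : FeatureMap Q M k) (ρ : ℝ) :
    (synthesisCoupling (mean F₀) (mean F₁) (center F₀) (center (mix F₀ F₁ 1))).map
      (fun z => (1 - ρ) • z.1 + ρ • z.2) =
    gaussianModel (fun i => (1 - ρ) * mean F₀ i + ρ * mean F₁ i) (covariance (mix F₀ F₁ ρ)) := by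
  rw [map_interpolate_synthesisCoupling, covariance_eq_crossCorrelation_center, mix_eq F₀ F₁ ρ,
    center_add_smul]

theorem isOTInterpolation_gaussianModel_mix (F₀ F₁ : FeatureMap Q M k) :
    IsOTInterpolation (modelOf F₀) (modelOf F₁) fun ρ =>
      gaussianModel (fun i => (1 - ρ) * mean F₀ i + ρ * mean F₁ i) (covariance (mix F₀ F₁ ρ)) :=
  ⟨_, (isOptimalCoupling_synthesisCoupling _ _ (fourier_center_mix_one F₀ F₁)).1,
    fun ρ _ => (map_interpolate_mix F₀ F₁ ρ).symm⟩

theorem IsOTInterpolation.eq_gaussianModel_mix {F₀ F₁ : FeatureMap Q M k}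
    (hs : ∀ w, w ≠ 0 → crossSpectrum F₀ F₁ w ≠ 0) {μ : ℝ → Measure (Field Q M k)}
    (hμ : IsOTInterpolation (modelOf F₀) (modelOf F₁) μ) {ρ : ℝ} (hρ : ρ ∈ Set.Icc (0 : ℝ) 1) :
    μ ρ = gaussianModel (fun i => (1 - ρ) * mean F₀ i + ρ * mean F₁ i)
      (covariance (mix F₀ F₁ ρ)) := by
  obtain ⟨π, hπ, h⟩ := hμ
  -- At `w = 0` the cross spectrum of the centered maps vanishes, but so does the centered spectrum
  -- itself; thus only nonzero frequencies need the hypothesis.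
  have hs' : ∀ w, crossSpectrum (center F₀) (center F₁) w = 0 →
      ∀ i, fourier (center F₁) w i = 0 := fun w h0 i => by
    by_cases hw : w = 0
    · simp [fourier_center, hw]
    · exact absurd (by simpa [crossSpectrum, fourier_center, hw] using h0) (hs w hw)
  rw [h ρ hρ, ← map_interpolate_mix, (isOptimalCoupling_synthesisCoupling (mean F₀) (mean F₁)
    (fourier_center_mix_one F₀ F₁)).2 hs' π hπ]

theorem modelOf_mix_of_nonneg {F₀ F₁ : FeatureMap Q M k} (h : 0 ≤ ∑ i, mean F₀ i * mean F₁ i)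
    (ρ : ℝ) : modelOf (mix F₀ F₁ ρ) =
      gaussianModel (fun i => (1 - ρ) * mean F₀ i + ρ * mean F₁ i) (covariance (mix F₀ F₁ ρ)) := by
  rw [modelOf, funext (mean_mix_of_nonneg h ρ)]

theorem continuous_mix (F₀ F₁ : FeatureMap Q M k) : Continuous (mix F₀ F₁) := by
  unfold mix; fun_prop

theorem continuous_gram_mix (F₀ F₁ : FeatureMap Q M k) :
    Continuous fun ρ => gram (mix F₀ F₁ ρ) := by
  have h := continuous_mix F₀ F₁
  unfold gram; fun_prop

theorem continuous_correlation_mix (F₀ F₁ : FeatureMap Q M k) :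
    Continuous fun ρ => correlation (mix F₀ F₁ ρ) := by
  have h := continuous_mix F₀ F₁
  unfold correlation; fun_prop

end TextureMixing

end

open TextureMixing in
theorem proposition2 (Q M k : ℕ) [NeZero Q] [NeZero M] (F₀ F₁ : FeatureMap Q M k) :
    -- the mixed feature map is real and has the announced Fourier transform
    (∀ ρ ∈ Set.Icc (0 : ℝ) 1, ∀ w i, fourier (mix F₀ F₁ ρ) w i =
        (1 - (ρ : ℂ)) * fourier F₀ w i + (ρ : ℂ) * alignedFourier F₀ F₁ w i) ∧
    -- its covariance, with the linearly interpolated mean, gives an optimal transport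
    -- interpolation, and the only one if the denominators do not vanish at nonzero frequencies
    IsOTInterpolation (modelOf F₀) (modelOf F₁) (fun ρ =>
        gaussianModel (fun i => (1 - ρ) * mean F₀ i + ρ * mean F₁ i)
          (covariance (mix F₀ F₁ ρ))) ∧
    ((∀ w, w ≠ 0 → crossSpectrum F₀ F₁ w ≠ 0) →
      ∀ μ : ℝ → Measure (Field Q M k), IsOTInterpolation (modelOf F₀) (modelOf F₁) μ →
        ∀ ρ ∈ Set.Icc (0 : ℝ) 1, μ ρ =
          gaussianModel (fun i => (1 - ρ) * mean F₀ i + ρ * mean F₁ i)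
            (covariance (mix F₀ F₁ ρ))) ∧
    -- if the means form no obtuse angle, the model of the mixed feature map is that
    -- interpolation, and the interpolated Gram matrix and correlation are those of the mixed map
    (0 ≤ ∑ i, mean F₀ i * mean F₁ i →
      IsOTInterpolation (modelOf F₀) (modelOf F₁) (fun ρ => modelOf (mix F₀ F₁ ρ)) ∧
      ((∀ w, w ≠ 0 → crossSpectrum F₀ F₁ w ≠ 0) →
        ∀ μ : ℝ → Measure (Field Q M k), IsOTInterpolation (modelOf F₀) (modelOf F₁) μ →
          ∀ ρ ∈ Set.Icc (0 : ℝ) 1,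
            μ ρ = modelOf (mix F₀ F₁ ρ) ∧
            (∀ i j, lawGram (μ ρ) i j = gram (mix F₀ F₁ ρ) i j) ∧
            (∀ p n, lawCorrelation (μ ρ) p n = correlation (mix F₀ F₁ ρ) p n))) ∧
    -- in every case the Gram matrix and the correlation of the mixed map are those of its model
    (∀ ρ ∈ Set.Icc (0 : ℝ) 1,
      (∀ i j, lawGram (modelOf (mix F₀ F₁ ρ)) i j = gram (mix F₀ F₁ ρ) i j) ∧
      (∀ p n, lawCorrelation (modelOf (mix F₀ F₁ ρ)) p n = correlation (mix F₀ F₁ ρ) p n)) ∧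
    -- and interpolate continuously between those of the two given maps
    (ContinuousOn (fun ρ => gram (mix F₀ F₁ ρ)) (Set.Icc 0 1) ∧
      gram (mix F₀ F₁ 0) = gram F₀ ∧ gram (mix F₀ F₁ 1) = gram F₁) ∧
    (ContinuousOn (fun ρ => correlation (mix F₀ F₁ ρ)) (Set.Icc 0 1) ∧
      correlation (mix F₀ F₁ 0) = correlation F₀ ∧
      correlation (mix F₀ F₁ 1) = correlation F₁) := by
  refine ⟨fun ρ _ => fourier_mix F₀ F₁ ρ, isOTInterpolation_gaussianModel_mix F₀ F₁,
    fun hs μ hμ ρ hρ => hμ.eq_gaussianModel_mix hs hρ, fun hm => ⟨?_, fun hs μ hμ ρ hρ => ?_⟩,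
    fun ρ _ => ⟨lawGram_modelOf _, lawCorrelation_modelOf _⟩,
    ⟨(continuous_gram_mix F₀ F₁).continuousOn, by rw [mix_zero], ?_⟩,
    ⟨(continuous_correlation_mix F₀ F₁).continuousOn, by rw [mix_zero], ?_⟩⟩
  · simpa only [modelOf_mix_of_nonneg hm] using isOTInterpolation_gaussianModel_mix F₀ F₁
  · have h : μ ρ = modelOf (mix F₀ F₁ ρ) := by
      rw [hμ.eq_gaussianModel_mix hs hρ, modelOf_mix_of_nonneg hm]
    rw [h]
    exact ⟨rfl, lawGram_modelOf _, lawCorrelation_modelOf _⟩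
  · funext i j
    simp only [gram_eq_crossCorrelation, crossCorrelation_mix_one]
  · funext p n
    simp only [correlation_eq_crossCorrelation, crossCorrelation_mix_one]
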